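/- A BL-algebra is an algebra $\langle A,\wedge,\vee,\odot,\to,0,1\rangle$ such that $\langle A,\odot,1\rangle$ is a commutative monoid, $\langle A,\wedge,\vee,0,1\rangle$ is a bounded lattice with least element $0$ and greatest element $1$, and for all $x,y,z\in A$: $(x\odot y)\to z=x\to(y\to z)$, $((x\to y)\odot x)\wedge y=(x\to y)\odot x$, $(x\wedge y)\to y=1$, $(x\to y)\vee(y\to x)=1$, and $x\odot(x\to y)=x\wedge y$. Homomorphisms are the maps preserving $\wedge,\vee,\odot,\to,0,1$. A BL-algebra $A$ is injective if for all BL-algebras $B,C$, every injective homomorphism $f:B\to C$ and every homomorphism $g:B\to A$ there is a homomorphism $h:C\to A$ with $hf=g$. A BL-algebra $B$ is a retract of a BL-algebra $A$ if there are homomorphisms $g:B\to A$ and $f:A\to B$ with $fg=1_B$. Let $R_{[0,1]}$ be the standard MV-algebra: the real unit interval $[0,1]$ with its usual lattice operations and constants, $x\odot y=\max(0,x+y-1)$ and $x\to y=\min(1,1-x+y)$; it is a BL-algebra. **Proposition.** A BL-algebra $A$ is injective in the variety of BL-algebras if and only if $A$ is a retract of a power $R_{[0,1]}^{I}$ (with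 componentwise operations) for some set $I$. -/

import Mathlib

universe u v

/-- A (bounded, commutative, integral) residuated lattice `⟨A, ⊓, ⊔, *, ⇨, ⊥, 1⟩`. Here `*` is the
monoid operation `⊙`, `⇨` is the residuum `→`, and the constants `0`, `1` of the
signature are the bottom `⊥` and the monoid unit `1`, which is also the top of the lattice. -/
class ResiduatedLattice (A : Type u) extends Lattice A, BoundedOrder A, CommMonoid A, HImp A where
  one_eq_top : (1 : A) = ⊤
  mul_himp : ∀ x y z : A, (x * y) ⇨ z = x ⇨ (y ⇨ z)
  himp_mul_inf : ∀ x y : A, ((x ⇨ y) * x) ⊓ y = (x ⇨ y) * x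
  inf_himp : ∀ x y : A, (x ⊓ y) ⇨ y = 1

/-- An MTL-algebra: a prelinear residuated lattice. -/
class MTLAlgebra (A : Type u) extends ResiduatedLattice A where
  prelinear : ∀ x y : A, (x ⇨ y) ⊔ (y ⇨ x) = 1

/-- A BL-algebra: a divisible MTL-algebra. -/
class BLAlgebra (A : Type u) extends MTLAlgebra A where
  mul_himp_self : ∀ x y : A, x * (x ⇨ y) = x ⊓ y

/-- Homomorphisms in the signature `⟨⊓, ⊔, *, ⇨, ⊥, 1⟩`. -/
structure ResiduatedLatticeHom (A : Type u) (B : Type v)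
    [ResiduatedLattice A] [ResiduatedLattice B] where
  toFun : A → B
  map_inf : ∀ x y, toFun (x ⊓ y) = toFun x ⊓ toFun y
  map_sup : ∀ x y, toFun (x ⊔ y) = toFun x ⊔ toFun y
  map_mul : ∀ x y, toFun (x * y) = toFun x * toFun y
  map_himp : ∀ x y, toFun (x ⇨ y) = toFun x ⇨ toFun y
  map_bot : toFun ⊥ = ⊥
  map_one : toFun 1 = 1

instance ResiduatedLatticeHom.instCoeFun (A : Type u) (B : Type v)
    [ResiduatedLattice A] [ResiduatedLattice B] :
    CoeFun (ResiduatedLatticeHom A B) (fun _ => A → B) :=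
  ⟨ResiduatedLatticeHom.toFun⟩

/-- `A` is injective in the variety of BL-algebras: homomorphisms into `A` extend along
monomorphisms (injective homomorphisms) of BL-algebras. -/
def BLAlgebra.IsInjective (A : Type u) [BLAlgebra A] : Prop :=
  ∀ (B C : Type u) [BLAlgebra B] [BLAlgebra C]
    (f : ResiduatedLatticeHom B C) (g : ResiduatedLatticeHom B A),
    Function.Injective f → ∃ h : ResiduatedLatticeHom C A, ∀ b : B, h (f b) = g b

/-- `B` is a retract of `A`. -/
def BLAlgebra.IsRetract (B : Type u) (A : Type v) [BLAlgebra B] [BLAlgebra A] : Prop :=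
  ∃ (g : ResiduatedLatticeHom B A) (f : ResiduatedLatticeHom A B), ∀ b : B, f (g b) = b

/-- Products of BL-algebras, with componentwise operations. -/
instance BLAlgebra.instPi {I : Type u} (A : I → Type v) [∀ i, BLAlgebra (A i)] :
    BLAlgebra (∀ i, A i) where
  one_eq_top := funext fun _ => ResiduatedLattice.one_eq_top
  mul_himp _ _ _ := funext fun _ => ResiduatedLattice.mul_himp _ _ _
  himp_mul_inf _ _ := funext fun _ => ResiduatedLattice.himp_mul_inf _ _
  inf_himp _ _ := funext fun _ => ResiduatedLattice.inf_himp _ _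
  prelinear _ _ := funext fun _ => MTLAlgebra.prelinear _ _
  mul_himp_self _ _ := funext fun _ => BLAlgebra.mul_himp_self _ _

/-- The real unit interval as carrier of the standard MV-algebra. It is a type synonym,
so that its multiplication is the Łukasiewicz one and not the product of reals. -/
def StandardMV : Type := unitInterval

namespace StandardMV

instance instLattice : Lattice StandardMV := inferInstanceAs (Lattice unitInterval)

instance instBoundedOrder : BoundedOrder StandardMV :=
  inferInstanceAs (BoundedOrder unitInterval)

/-- The underlying real number. -/
def val (x : StandardMV) : ℝ := Subtype.val x

theorem val_nonneg (x : StandardMV) : 0 ≤ x.val := x.2.1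

theorem val_le_one (x : StandardMV) : x.val ≤ 1 := x.2.2

theorem ext {x y : StandardMV} (h : x.val = y.val) : x = y := Subtype.ext h

theorem val_inf (x y : StandardMV) : (x ⊓ y).val = min x.val y.val := rfl

theorem val_sup (x y : StandardMV) : (x ⊔ y).val = max x.val y.val := rfl

theorem val_top : (⊤ : StandardMV).val = 1 := rfl

theorem val_bot : (⊥ : StandardMV).val = 0 := rfl

/-- `x ⊙ y = max 0 (x + y - 1)`. -/
instance instMul : Mul StandardMV :=
  ⟨fun x y => ⟨max 0 (x.val + y.val - 1), le_max_left _ _,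
    max_le zero_le_one (by linarith [x.val_le_one, y.val_le_one])⟩⟩

instance instOne : One StandardMV := ⟨⟨1, zero_le_one, le_refl 1⟩⟩

/-- `x → y = min 1 (1 - x + y)`. -/
instance instHImp : HImp StandardMV :=
  ⟨fun x y => ⟨min 1 (1 - x.val + y.val),
    le_min zero_le_one (by linarith [x.val_le_one, y.val_nonneg]), min_le_left _ _⟩⟩

theorem val_mul (x y : StandardMV) : (x * y).val = max 0 (x.val + y.val - 1) := rfl

theorem val_himp (x y : StandardMV) : (x ⇨ y).val = min 1 (1 - x.val + y.val) := rfl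

theorem val_one : (1 : StandardMV).val = 1 := rfl

instance instCommMonoid : CommMonoid StandardMV where
  mul_assoc x y z := by
    apply ext
    simp only [val_mul]
    grind [x.val_le_one, y.val_le_one, z.val_le_one]
  one_mul x := by
    apply ext
    simp only [val_mul, val_one]
    grind [x.val_nonneg]
  mul_one x := by
    apply ext
    simp only [val_mul, val_one]
    grind [x.val_nonneg]
  mul_comm x y := by
    apply ext
    simp only [val_mul]
    grind

/-- The standard MV-algebra on the real unit interval is a BL-algebra. -/
instance instBLAlgebra : BLAlgebra StandardMV where
  one_eq_top := rfl
  mul_himp x y z := by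
    apply ext
    simp only [val_mul, val_himp]
    grind [x.val_le_one, y.val_le_one, z.val_nonneg]
  himp_mul_inf x y := by
    apply ext
    simp only [val_mul, val_himp, val_inf]
    grind [x.val_nonneg, x.val_le_one, y.val_nonneg]
  inf_himp x y := by
    apply ext
    simp only [val_himp, val_inf, val_one]
    grind
  prelinear x y := by
    apply ext
    simp only [val_himp, val_sup, val_one]
    grind
  mul_himp_self x y := by
    apply ext
    simp only [val_mul, val_himp, val_inf]
    grind [x.val_nonneg, x.val_le_one, y.val_nonneg]

end StandardMV

-- The standard MV-algebra [0,1] is itself injective, and powers and retracts inherit this. Given an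
-- embedding B → C and φ : B → [0,1], the image of φ⁻¹(1) generates a proper filter of C, contained
-- in a maximal filter M. The quotient C/M is a simple chain, which Hölder's theorem maps into [0,1]
-- (`exists_hom`). The resulting ψ is 1 wherever φ is, and this forces ψ to extend φ, since a
-- homomorphism to [0,1] is determined by its filter (`hom_ext_of_eq_one`).
--
-- Conversely, let A be injective. If its radical (the elements sent to 1 by every homomorphism to
-- [0,1]) is {1}, then A embeds in a power of [0,1], and injectivity splits the embedding.
-- Retracting a suitable reduced power onto A shows that the radical has a least element e. It is
-- idempotent with e → 0 = 0, so the Gödel chain 0 < m < 1 maps to A with m ↦ e. Extend this map to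
-- 0 < s < m < 1. Then s also goes to e, and m → s = s becomes e → e = e, whence e = 1.

universe w

/-! ### Residuated lattices and maximal filters -/

namespace ResiduatedLattice

variable {A : Type u} [ResiduatedLattice A] {x y z w : A}

theorem himp_eq_one_iff : x ⇨ y = 1 ↔ x ≤ y := by
  constructor
  · intro h
    have := himp_mul_inf x y
    rw [h, one_mul] at this
    exact inf_eq_left.mp this
  · intro h
    have := inf_himp x y
    rwa [inf_eq_left.mpr h] at this

theorem mul_le_iff : x * y ≤ z ↔ x ≤ y ⇨ z := by
  rw [← himp_eq_one_iff, mul_himp, himp_eq_one_iff]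

theorem le_one (x : A) : x ≤ 1 := one_eq_top (A := A) ▸ le_top

theorem himp_mul_le (x y : A) : (x ⇨ y) * x ≤ y := mul_le_iff.mpr le_rfl

instance instIsOrderedMonoid : IsOrderedMonoid A where
  mul_le_mul_left x y h z := by
    rw [mul_le_iff]
    exact h.trans (mul_le_iff.mp le_rfl)

theorem mul_le_left (x y : A) : x * y ≤ x := by
  simpa using mul_le_mul_right (le_one y) x

theorem mul_le_right (x y : A) : x * y ≤ y := by
  simpa using mul_le_mul_left (le_one x) y

theorem mul_bot (x : A) : x * ⊥ = ⊥ := le_bot_iff.mp (mul_le_right x ⊥)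

theorem one_himp (x : A) : 1 ⇨ x = x :=
  le_antisymm (by simpa using himp_mul_le 1 x) (by rw [← mul_le_iff, mul_one])

theorem himp_trans_le (x y z : A) : (x ⇨ y) * (y ⇨ z) ≤ x ⇨ z := by
  rw [← mul_le_iff]
  calc (x ⇨ y) * (y ⇨ z) * x = (y ⇨ z) * ((x ⇨ y) * x) := by ac_rfl
    _ ≤ (y ⇨ z) * y := mul_le_mul_right (himp_mul_le x y) _
    _ ≤ z := himp_mul_le y z

theorem himp_mul_himp_le (x y z w : A) : (x ⇨ y) * (z ⇨ w) ≤ (x * z) ⇨ (y * w) := by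
  rw [← mul_le_iff]
  calc (x ⇨ y) * (z ⇨ w) * (x * z) = ((x ⇨ y) * x) * ((z ⇨ w) * z) := by ac_rfl
    _ ≤ y * w := mul_le_mul' (himp_mul_le x y) (himp_mul_le z w)

theorem sup_mul_le_of_le (h : x * z ≤ w) (h' : y * z ≤ w) : (x ⊔ y) * z ≤ w :=
  mul_le_iff.mpr (sup_le (mul_le_iff.mp h) (mul_le_iff.mp h'))

theorem sup_mul_eq_one (h : x ⊔ y = 1) (h' : x ⊔ z = 1) : x ⊔ y * z = 1 := by
  refine le_antisymm (le_one _) ?_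
  rw [← one_mul (1 : A)]
  nth_rewrite 1 [← h]
  refine sup_mul_le_of_le ((mul_le_left _ _).trans le_sup_left) ?_
  rw [mul_comm, ← h']
  refine sup_mul_le_of_le ((mul_le_left _ _).trans le_sup_left) ?_
  rw [mul_comm]
  exact le_sup_right

theorem sup_pow_eq_one (h : x ⊔ y = 1) (n : ℕ) : x ⊔ y ^ n = 1 := by
  induction n with
  | zero => rw [pow_zero]; exact sup_eq_right.mpr (le_one x)
  | succ n ih => rw [pow_succ]; exact sup_mul_eq_one ih h

theorem pow_sup_pow_eq_one (h : x ⊔ y = 1) (m n : ℕ) : x ^ m ⊔ y ^ n = 1 := by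
  rw [sup_comm]
  exact sup_pow_eq_one (by rw [sup_comm]; exact sup_pow_eq_one h n) m

theorem pow_le_pow_of_le (x : A) {m n : ℕ} (h : m ≤ n) : x ^ n ≤ x ^ m := by
  obtain ⟨k, rfl⟩ := Nat.exists_eq_add_of_le h
  rw [pow_add]
  exact mul_le_left _ _

/-- A proper (implicative) filter. -/
structure IsProperFilter (F : Set A) : Prop where
  one_mem : 1 ∈ F
  mul_mem : ∀ {x y}, x ∈ F → y ∈ F → x * y ∈ F
  mem_of_le : ∀ {x y}, x ∈ F → x ≤ y → y ∈ F
  bot_notMem : ⊥ ∉ F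

theorem IsProperFilter.exists_le_maximal {F : Set A} (hF : IsProperFilter F) :
    ∃ M, F ⊆ M ∧ Maximal IsProperFilter M := by
  refine zorn_subset_nonempty {S : Set A | IsProperFilter S} ?_ F hF
  intro c hc hchain hne
  refine ⟨⋃₀ c, ⟨?_, ?_, ?_, ?_⟩, fun s hs => Set.subset_sUnion_of_mem hs⟩
  · obtain ⟨s, hs⟩ := hne
    exact ⟨s, hs, (hc hs).one_mem⟩
  · rintro x y ⟨s, hs, hx⟩ ⟨t, ht, hy⟩
    rcases hchain.total hs ht with h | h
    · exact ⟨t, ht, (hc ht).mul_mem (h hx) hy⟩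
    · exact ⟨s, hs, (hc hs).mul_mem hx (h hy)⟩
  · rintro x y ⟨s, hs, hx⟩ hxy
    exact ⟨s, hs, (hc hs).mem_of_le hx hxy⟩
  · rintro ⟨s, hs, h⟩
    exact (hc hs).bot_notMem h

/-- Otherwise the filter generated by M and x would be proper, against maximality. -/
theorem exists_pow_himp_bot_mem {M : Set A} (hM : Maximal IsProperFilter M) (h : x ∉ M) :
    ∃ n : ℕ, x ^ n ⇨ ⊥ ∈ M := by
  by_contra! hn
  let S : Set A := {y | ∃ n : ℕ, ∃ m ∈ M, m * x ^ n ≤ y}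
  have hS : IsProperFilter S := by
    refine ⟨⟨0, 1, hM.prop.one_mem, by simp⟩, ?_, ?_, ?_⟩
    · rintro y z ⟨n, m, hm, hy⟩ ⟨n', m', hm', hz⟩
      refine ⟨n + n', m * m', hM.prop.mul_mem hm hm', ?_⟩
      calc m * m' * x ^ (n + n') = (m * x ^ n) * (m' * x ^ n') := by rw [pow_add]; ac_rfl
        _ ≤ y * z := mul_le_mul' hy hz
    · rintro y z ⟨n, m, hm, hy⟩ hyz
      exact ⟨n, m, hm, hy.trans hyz⟩
    · rintro ⟨n, m, hm, hy⟩
      exact hn n (hM.prop.mem_of_le hm (mul_le_iff.mp hy))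
  have hMS : M ⊆ S := fun m hm => ⟨0, m, hm, by simp⟩
  exact h (hM.le_of_ge hS hMS ⟨1, 1, hM.prop.one_mem, by simp⟩)

end ResiduatedLattice

open ResiduatedLattice in
theorem MTLAlgebra.himp_mem_or_himp_mem {A : Type u} [MTLAlgebra A] {M : Set A}
    (hM : Maximal IsProperFilter M) (x y : A) : x ⇨ y ∈ M ∨ y ⇨ x ∈ M := by
  by_contra! h
  obtain ⟨m, hm⟩ := exists_pow_himp_bot_mem hM h.1
  obtain ⟨n, hn⟩ := exists_pow_himp_bot_mem hM h.2
  refine hM.prop.bot_notMem (hM.prop.mem_of_le (hM.prop.mul_mem hm hn) ?_)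
  -- By prelinearity (x → y)^m ∨ (y → x)^n = 1, and each joinand is annihilated by one of the two
  -- negations in M.
  rw [← one_mul (_ * _), ← pow_sup_pow_eq_one (prelinear x y) m n]
  refine sup_mul_le_of_le ?_ ?_
  · rw [← mul_assoc, mul_comm (_ ^ m)]
    exact (mul_le_left _ _).trans (himp_mul_le _ _)
  · rw [mul_left_comm, mul_comm (_ ^ n)]
    exact (mul_le_right _ _).trans (himp_mul_le _ _)

/-- The total preorder induced on a BL-algebra by a maximal filter, abstracted: a simple totally
preordered residuated monoid with divisibility. -/
structure SimpleResiduatedPreorder {A : Type u} [BLAlgebra A] (r : A → A → Prop) : Prop where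
  of_le : ∀ {x y}, x ≤ y → r x y
  trans : ∀ {x y z}, r x y → r y z → r x z
  total : ∀ x y, r x y ∨ r y x
  mul_mono : ∀ {x y z w}, r x y → r z w → r (x * z) (y * w)
  mul_iff : ∀ {x y z}, r (x * y) z ↔ r x (y ⇨ z)
  nilpotent : ∀ {x}, ¬ r 1 x → ∃ n : ℕ, r (x ^ n) ⊥
  one_not_bot : ¬ r 1 ⊥
  inf_of_rel : ∀ {x y}, r x y → r x (x ⊓ y)
  sup_of_rel : ∀ {x y}, r x y → r (x ⊔ y) y

open ResiduatedLattice in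
-- This is the order of the chain A/M pulled back to A, so that no quotient is needed.
theorem SimpleResiduatedPreorder.of_maximal {A : Type u} [BLAlgebra A] {M : Set A}
    (hM : Maximal IsProperFilter M) :
    SimpleResiduatedPreorder (fun x y : A => x ⇨ y ∈ M) where
  of_le h := by rw [himp_eq_one_iff.mpr h]; exact hM.prop.one_mem
  trans h h' := hM.prop.mem_of_le (hM.prop.mul_mem h h') (himp_trans_le _ _ _)
  total := MTLAlgebra.himp_mem_or_himp_mem hM
  mul_mono h h' := hM.prop.mem_of_le (hM.prop.mul_mem h h') (himp_mul_himp_le _ _ _ _)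
  mul_iff := by simp only [mul_himp, implies_true]
  nilpotent h := exists_pow_himp_bot_mem hM (by simpa only [one_himp] using h)
  one_not_bot := by simpa only [one_himp] using hM.prop.bot_notMem
  inf_of_rel {x y} h := by
    refine hM.prop.mem_of_le h ?_
    rw [← mul_le_iff, mul_comm, BLAlgebra.mul_himp_self]
  sup_of_rel {x y} h := by
    refine hM.prop.mem_of_le h ?_
    rw [← mul_le_iff, mul_comm]
    exact sup_mul_le_of_le (by rw [mul_comm]; exact himp_mul_le _ _) (mul_le_left _ _)

/-! ### Hölder's theorem for simple BL-chains -/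

namespace SimpleResiduatedPreorder

open ResiduatedLattice Filter Topology

variable {A : Type u} [BLAlgebra A] {r : A → A → Prop} {a x y : A}

/-- The least exponent at which the powers of `a` vanish. -/
noncomputable def nilOrder (r : A → A → Prop) (a : A) : ℕ := sInf {n | r (a ^ n) ⊥}

open Classical in
/-- The greatest exponent, up to the nilpotency order, for which the power of `a` is above `x`. -/
noncomputable def index (r : A → A → Prop) (a x : A) : ℕ :=
  Nat.findGreatest (fun k => r x (a ^ k)) (nilOrder r a)

open Classical in
theorem index_le_nilOrder : index r a x ≤ nilOrder r a := Nat.findGreatest_le _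

open Classical in
theorem le_index {j : ℕ} (hj : j ≤ nilOrder r a) (h : r x (a ^ j)) : j ≤ index r a x :=
  Nat.le_findGreatest hj h

variable (hr : SimpleResiduatedPreorder r)
include hr

open Classical in
theorem rel_pow_index : r x (a ^ index r a x) := by
  refine Nat.findGreatest_spec (P := fun k => r x (a ^ k)) (Nat.zero_le _) ?_
  rw [pow_zero]
  exact hr.of_le (le_one x)

theorem pow_anti (a : A) {m n : ℕ} (h : m ≤ n) : r (a ^ n) (a ^ m) :=
  hr.of_le (pow_le_pow_of_le a h)

theorem pow_nilOrder (ha : ¬ r 1 a) : r (a ^ nilOrder r a) ⊥ :=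
  Nat.sInf_mem (s := {n | r (a ^ n) ⊥}) (hr.nilpotent ha)

theorem pow_rel_bot_iff (ha : ¬ r 1 a) {n : ℕ} : r (a ^ n) ⊥ ↔ nilOrder r a ≤ n :=
  ⟨fun h => Nat.sInf_le h, fun h => hr.trans (hr.pow_anti a h) (hr.pow_nilOrder ha)⟩

theorem nilOrder_pos (ha : ¬ r 1 a) : 0 < nilOrder r a := by
  by_contra! h
  exact hr.one_not_bot (by simpa using (hr.pow_rel_bot_iff ha (n := 0)).mpr h)

theorem pow_index_succ_rel (ha : ¬ r 1 a) (x : A) : r (a ^ (index r a x + 1)) x := by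
  rcases hr.total (a ^ (index r a x + 1)) x with h | h
  · exact h
  · by_cases hk : index r a x + 1 ≤ nilOrder r a
    · have := le_index hk h
      omega
    · exact hr.trans ((hr.pow_rel_bot_iff ha).mpr (by omega)) (hr.of_le bot_le)

theorem not_pow_rel_pow_succ (ha : ¬ r 1 a) {j : ℕ} (hj : j < nilOrder r a) :
    ¬ r (a ^ j) (a ^ (j + 1)) := by
  intro h
  have key : ∀ m, r (a ^ j) (a ^ (j + m)) := by
    intro m
    induction m with
    | zero => exact hr.of_le le_rfl
    | succ m ih =>
      refine hr.trans h ?_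
      rw [pow_succ, ← add_assoc, pow_succ]
      exact hr.mul_mono ih (hr.of_le le_rfl)
  have := (hr.pow_rel_bot_iff ha).mp (hr.trans (key (nilOrder r a))
    ((hr.pow_rel_bot_iff ha).mpr (Nat.le_add_left _ _)))
  omega

theorem index_le_of_pow_rel (ha : ¬ r 1 a) {j : ℕ} (h : r (a ^ j) x) : index r a x ≤ j := by
  by_contra! hj
  refine hr.not_pow_rel_pow_succ ha (hj.trans_le index_le_nilOrder) ?_
  exact hr.trans h (hr.trans hr.rel_pow_index (hr.pow_anti a hj))

theorem index_anti (h : r x y) : index r a y ≤ index r a x :=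
  le_index index_le_nilOrder (hr.trans h hr.rel_pow_index)

theorem index_bot : index r a ⊥ = nilOrder r a :=
  le_antisymm index_le_nilOrder (le_index le_rfl (hr.of_le bot_le))

theorem index_one (ha : ¬ r 1 a) : index r a 1 = 0 :=
  Nat.le_zero.mp (hr.index_le_of_pow_rel ha (by simpa using hr.of_le le_rfl))

theorem min_le_index_mul (x y : A) :
    min (nilOrder r a) (index r a x + index r a y) ≤ index r a (x * y) := by
  refine le_index (min_le_left _ _) (hr.trans ?_ (hr.pow_anti a (min_le_right _ _)))
  rw [pow_add]
  exact hr.mul_mono hr.rel_pow_index hr.rel_pow_index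

-- Every x lies between two powers of a whose exponents differ by δ, so δ is the error of measuring
-- by powers of a. The value 1 always works; 0 works when every x is equivalent to a power of a.
variable {δ : ℕ} (hδ : ∀ x, r (a ^ (index r a x + δ)) x)
include hδ

theorem index_mul_le (ha : ¬ r 1 a) (x y : A) :
    index r a (x * y) ≤ index r a x + index r a y + 2 * δ := by
  refine hr.index_le_of_pow_rel ha ?_
  rw [show index r a x + index r a y + 2 * δ = (index r a x + δ) + (index r a y + δ) by ring,
    pow_add]
  exact hr.mul_mono (hδ x) (hδ y)

theorem index_le_index_himp_add (ha : ¬ r 1 a) (x y : A) :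
    index r a y ≤ index r a (x ⇨ y) + index r a x + 2 * δ :=
  (hr.index_anti (hr.of_le (himp_mul_le x y))).trans (hr.index_mul_le hδ ha _ _)

theorem index_himp_add_le (ha : ¬ r 1 a) (h : r y x) :
    index r a (x ⇨ y) + index r a x ≤ index r a y + δ := by
  rcases Nat.eq_zero_or_pos (index r a (x ⇨ y)) with h0 | h0
  · rw [h0, zero_add]
    exact (hr.index_anti h).trans (Nat.le_add_right _ _)
  · by_contra! hlt
    -- The exponent one below the index of x ⇨ y is too small to reach x ⇨ y. If the sum of indices
    -- overshot, that power times x would already be below y.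
    have h1 : ¬ r (a ^ (index r a (x ⇨ y) - 1)) (x ⇨ y) := fun h1 => by
      have := hr.index_le_of_pow_rel ha h1
      omega
    rw [← hr.mul_iff] at h1
    refine h1 (hr.trans (hr.mul_mono (hr.of_le le_rfl) (hr.rel_pow_index (a := a))) ?_)
    rw [← pow_add]
    exact hr.trans (hr.pow_anti a (by omega)) (hδ y)

omit hδ in
-- An a of maximal nilpotency order n behaves like a coatom. If x were not equivalent to a power of
-- a, then z = a^k → x would lie strictly between a and 1. Divisibility factors a through z and z →
-- a, both different from 1; the larger factor v has a below v² and v^n = 0, so a vanishes before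
-- the exponent n.
theorem pow_index_rel_of_forall_pow {n : ℕ} (hn : ∀ b, ¬ r 1 b → r (b ^ n) ⊥)
    (ha : ¬ r 1 a) (han : n ≤ nilOrder r a) (x : A) : r (a ^ index r a x) x := by
  have hna : nilOrder r a = n := le_antisymm ((hr.pow_rel_bot_iff ha).mp (hn a ha)) han
  have hpos := hr.nilOrder_pos ha
  by_contra hx
  have div : ∀ {b c : A}, r c b → r c (b * (b ⇨ c)) := fun {b c} h => by
    rw [BLAlgebra.mul_himp_self]
    exact hr.trans (hr.inf_of_rel h) (hr.of_le (inf_comm c b).le)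
  set z := a ^ index r a x ⇨ x with hz
  have hz1 : ¬ r 1 z := by rwa [hz, ← hr.mul_iff, one_mul]
  have hza : ¬ r z a := by
    intro h
    have h1 : r x (a ^ (index r a x + 1)) := by
      refine hr.trans (div (hr.rel_pow_index (a := a))) ?_
      rw [pow_succ]
      exact hr.mul_mono (hr.of_le le_rfl) h
    rcases Nat.lt_or_ge (index r a x) (nilOrder r a) with hk | hk
    · have := le_index hk h1
      omega
    · exact hx (hr.trans ((hr.pow_rel_bot_iff ha).mpr hk) (hr.of_le bot_le))
  have haz : r a z := (hr.total a z).resolve_right hza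
  have hw1 : ¬ r 1 (z ⇨ a) := by rwa [← hr.mul_iff, one_mul]
  obtain ⟨v, hzv, hwv, hv1⟩ : ∃ v, r z v ∧ r (z ⇨ a) v ∧ ¬ r 1 v := by
    rcases hr.total z (z ⇨ a) with h | h
    · exact ⟨_, h, hr.of_le le_rfl, hw1⟩
    · exact ⟨_, hr.of_le le_rfl, h, hz1⟩
  have hav : r a (v ^ 2) := hr.trans (div haz) (by rw [pow_two]; exact hr.mul_mono hzv hwv)
  have hpow : ∀ m, r (a ^ m) (v ^ (2 * m)) := by
    intro m
    induction m with
    | zero => simpa using hr.of_le le_rfl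
    | succ m ih =>
      rw [pow_succ, Nat.mul_succ, pow_add]
      exact hr.mul_mono ih hav
  have hvn : nilOrder r v ≤ n := (hr.pow_rel_bot_iff hv1).mp (hn v hv1)
  rcases Nat.lt_or_ge n 2 with h2 | h2
  · have h1n : n = 1 := by omega
    exact hza (hr.trans (by simpa [h1n] using hn z hz1) (hr.of_le bot_le))
  -- For n ≥ 2 one has 2(n - 1) ≥ n, so a^(n-1) already vanishes.
  · have := (hr.pow_rel_bot_iff ha).mp
      (hr.trans (hpow (n - 1)) ((hr.pow_rel_bot_iff hv1).mpr (by omega)))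
    omega

omit hδ in
-- If nilpotency orders are bounded, a constant sequence of maximal order has error 0. If not,
-- orders tend to infinity and the error 1 becomes negligible.
theorem exists_seq : ∃ (a : ℕ → A) (δ : ℕ → ℕ), (∀ n, ¬ r 1 (a n)) ∧
    (∀ n x, r (a n ^ (index r (a n) x + δ n)) x) ∧
    Tendsto (fun n => (δ n : ℝ) / nilOrder r (a n)) atTop (𝓝 0) := by
  by_cases H : ∃ n : ℕ, ∀ b, ¬ r 1 b → r (b ^ n) ⊥
  · classical
    obtain ⟨n, hn, hmin⟩ : ∃ n : ℕ, (∀ b, ¬ r 1 b → r (b ^ n) ⊥) ∧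
        ∀ m < n, ¬ ∀ b, ¬ r 1 b → r (b ^ m) ⊥ :=
      ⟨Nat.find H, Nat.find_spec H, fun m hm => Nat.find_min H hm⟩
    have hn0 : n ≠ 0 := by
      rintro rfl
      exact hr.one_not_bot (by simpa using hn ⊥ hr.one_not_bot)
    have := hmin (n - 1) (by omega)
    push Not at this
    obtain ⟨a, ha, han⟩ := this
    rw [hr.pow_rel_bot_iff ha] at han
    refine ⟨fun _ => a, fun _ => 0, fun _ => ha, fun _ x => ?_, by simp⟩
    exact hr.pow_index_rel_of_forall_pow hn ha (by omega) x
  · push Not at H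
    choose a ha han using H
    refine ⟨a, fun _ => 1, ha, fun n x => hr.pow_index_succ_rel (ha n) x, ?_⟩
    have hlt : ∀ n, n < nilOrder r (a n) := fun n => by
      rw [← not_le, ← hr.pow_rel_bot_iff (ha n)]
      exact han n
    simp only [Nat.cast_one, one_div]
    refine tendsto_inv_atTop_zero.comp (tendsto_natCast_atTop_atTop.comp ?_)
    exact tendsto_atTop_mono (fun n => (hlt n).le) tendsto_id

omit hδ in
-- d is the ultralimit of index divided by nilpotency order; it measures the distance from 1. The
-- integer inequalities become exact in the limit because the relative error tends to 0.
theorem exists_real_index : ∃ d : A → ℝ, (∀ x, 0 ≤ d x) ∧ (∀ x, d x ≤ 1) ∧ d ⊥ = 1 ∧ d 1 = 0 ∧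
    (∀ x y, r x y → d y ≤ d x) ∧ (∀ x y, d (x * y) = min 1 (d x + d y)) ∧
    ∀ x y, r y x → d (x ⇨ y) = d y - d x := by
  obtain ⟨a, δ, ha, hδ, hlim⟩ := hr.exists_seq
  let U : Ultrafilter ℕ := hyperfilter ℕ
  have hU : (U : Filter ℕ) ≤ atTop := Nat.hyperfilter_le_atTop
  let q : A → ℕ → ℝ := fun x n => (index r (a n) x : ℝ) / nilOrder r (a n)
  let ε : ℕ → ℝ := fun n => (δ n : ℝ) / nilOrder r (a n)
  have hpos : ∀ n, (0 : ℝ) < nilOrder r (a n) := fun n => by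
    exact_mod_cast hr.nilOrder_pos (ha n)
  have hε : Tendsto ε U (𝓝 0) := hlim.mono_left hU
  have hq0 : ∀ x n, 0 ≤ q x n := fun x n => by positivity
  have hq1 : ∀ x n, q x n ≤ 1 := fun x n => by
    rw [div_le_one (hpos n)]
    exact_mod_cast index_le_nilOrder
  have hex : ∀ x, ∃ t ∈ Set.Icc (0 : ℝ) 1, Tendsto (q x) U (𝓝 t) := fun x => by
    have := isCompact_Icc.ultrafilter_le_nhds (s := Set.Icc (0 : ℝ) 1) (U.map (q x)) (by
      rw [le_principal_iff]
      exact mem_map.mpr (Eventually.of_forall fun n => ⟨hq0 x n, hq1 x n⟩))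
    exact this
  choose d hd hdlim using hex
  have hanti : ∀ x y, r x y → d y ≤ d x := fun x y h =>
    le_of_tendsto_of_tendsto' (hdlim y) (hdlim x) fun n => by
      have := hr.index_anti (a := a n) h
      simp only [q]
      gcongr
  refine ⟨d, fun x => (hd x).1, fun x => (hd x).2, ?_, ?_, hanti, fun x y => ?_, fun x y h => ?_⟩
  · refine tendsto_nhds_unique (hdlim ⊥) (tendsto_const_nhds.congr fun n => ?_)
    simp only [q]
    rw [hr.index_bot, div_self (hpos n).ne']
  · refine tendsto_nhds_unique (hdlim 1) (tendsto_const_nhds.congr fun n => ?_)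
    simp only [q]
    rw [hr.index_one (ha n), Nat.cast_zero, zero_div]
  · refine le_antisymm (le_min (hd _).2 ?_) ?_
    · have h2 : Tendsto (fun n => q x n + q y n + 2 * ε n) U (𝓝 (d x + d y)) := by
        simpa using ((hdlim x).add (hdlim y)).add (hε.const_mul 2)
      refine le_of_tendsto_of_tendsto' (hdlim _) h2 fun n => ?_
      simp only [q, ε, ← add_div, ← mul_div_assoc]
      rw [div_le_div_iff_of_pos_right (hpos n)]
      exact_mod_cast hr.index_mul_le (hδ n) (ha n) x y
    · refine le_of_tendsto_of_tendsto'
        (tendsto_const_nhds.min ((hdlim x).add (hdlim y))) (hdlim _) fun n => ?_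
      simp only [q, ← add_div]
      rw [← div_self (hpos n).ne', min_div_div_right (hpos n).le,
        div_le_div_iff_of_pos_right (hpos n)]
      exact_mod_cast hr.min_le_index_mul x y
  · refine le_antisymm ?_ ?_
    · rw [le_sub_iff_add_le]
      have h2 : Tendsto (fun n => q y n + ε n) U (𝓝 (d y)) := by
        simpa using (hdlim y).add hε
      refine le_of_tendsto_of_tendsto' ((hdlim _).add (hdlim x)) h2 fun n => ?_
      simp only [q, ε, ← add_div]
      rw [div_le_div_iff_of_pos_right (hpos n)]
      exact_mod_cast hr.index_himp_add_le (hδ n) (ha n) h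
    · rw [sub_le_iff_le_add]
      have h2 : Tendsto (fun n => q (x ⇨ y) n + q x n + 2 * ε n) U (𝓝 (d (x ⇨ y) + d x)) := by
        simpa using ((hdlim (x ⇨ y)).add (hdlim x)).add (hε.const_mul 2)
      refine le_of_tendsto_of_tendsto' (hdlim _) h2 fun n => ?_
      simp only [q, ε, ← add_div, ← mul_div_assoc]
      rw [div_le_div_iff_of_pos_right (hpos n)]
      exact_mod_cast hr.index_le_index_himp_add (hδ n) (ha n) x y

omit hδ in
/-- Hölder's theorem: a simple BL-chain maps to the standard MV-algebra. -/
theorem exists_hom : ∃ φ : ResiduatedLatticeHom A StandardMV, ∀ x, r 1 x → φ x = 1 := by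
  obtain ⟨d, h0, h1, hbot, hone, hanti, hmul, himp⟩ := hr.exists_real_index
  have hle : ∀ {x y}, x ≤ y → d y ≤ d x := fun h => hanti _ _ (hr.of_le h)
  let F : A → StandardMV := fun x => ⟨1 - d x, by linarith [h1 x], by linarith [h0 x]⟩
  have hF : ∀ x, (F x).val = 1 - d x := fun _ => rfl
  have hinf : ∀ x y, r x y → d (x ⊓ y) = max (d x) (d y) := fun x y h => by
    rw [max_eq_left (hanti _ _ h)]
    exact le_antisymm (hanti _ _ (hr.inf_of_rel h)) (hle inf_le_left)
  have hsup : ∀ x y, r x y → d (x ⊔ y) = min (d x) (d y) := fun x y h => by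
    rw [min_eq_right (hanti _ _ h)]
    exact le_antisymm (hle le_sup_right) (hanti _ _ (hr.sup_of_rel h))
  refine ⟨⟨F, fun x y => ?_, fun x y => ?_, fun x y => ?_, fun x y => ?_, ?_, ?_⟩, fun x hx => ?_⟩
  · apply StandardMV.ext
    simp only [StandardMV.val_inf, hF]
    have : d (x ⊓ y) = max (d x) (d y) := by
      rcases hr.total x y with h | h
      · exact hinf x y h
      · rw [inf_comm, max_comm]
        exact hinf y x h
    grind
  · apply StandardMV.ext
    simp only [StandardMV.val_sup, hF]
    have : d (x ⊔ y) = min (d x) (d y) := by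
      rcases hr.total x y with h | h
      · exact hsup x y h
      · rw [sup_comm, min_comm]
        exact hsup y x h
    grind
  · apply StandardMV.ext
    simp only [StandardMV.val_mul, hF]
    grind
  · apply StandardMV.ext
    simp only [StandardMV.val_himp, hF]
    rcases hr.total x y with h | h
    · have h2 : d (x ⇨ y) ≤ d 1 := hanti _ _ (hr.mul_iff.mp (by rwa [one_mul]))
      grind
    · grind
  · apply StandardMV.ext
    rw [hF, hbot, StandardMV.val_bot, sub_self]
  · apply StandardMV.ext
    rw [hF, hone, StandardMV.val_one, sub_zero]
  · apply StandardMV.ext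
    have := hanti _ _ hx
    rw [hF, StandardMV.val_one]
    linarith [h0 x]

end SimpleResiduatedPreorder

open ResiduatedLattice in
/-- Every proper filter of a BL-algebra is sent to `1` by some homomorphism to the standard
MV-algebra. -/
theorem BLAlgebra.exists_hom_of_isProperFilter {A : Type u} [BLAlgebra A] {F : Set A}
    (hF : IsProperFilter F) : ∃ φ : ResiduatedLatticeHom A StandardMV, ∀ x ∈ F, φ x = 1 := by
  obtain ⟨M, hFM, hM⟩ := hF.exists_le_maximal
  obtain ⟨φ, hφ⟩ := (SimpleResiduatedPreorder.of_maximal hM).exists_hom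
  exact ⟨φ, fun x hx => hφ x (by simpa only [one_himp] using hFM hx)⟩

/-! ### Homomorphisms and products -/

namespace ResiduatedLatticeHom

variable {A : Type u} {B : Type v} {C : Type w} [ResiduatedLattice A] [ResiduatedLattice B]
  [ResiduatedLattice C]

/-- Composition of homomorphisms. -/
def comp (g : ResiduatedLatticeHom B C) (f : ResiduatedLatticeHom A B) :
    ResiduatedLatticeHom A C where
  toFun x := g (f x)
  map_inf _ _ := by rw [f.map_inf, g.map_inf]
  map_sup _ _ := by rw [f.map_sup, g.map_sup]
  map_mul _ _ := by rw [f.map_mul, g.map_mul]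
  map_himp _ _ := by rw [f.map_himp, g.map_himp]
  map_bot := by rw [f.map_bot, g.map_bot]
  map_one := by rw [f.map_one, g.map_one]

/-- The identity homomorphism. -/
def id (A : Type u) [ResiduatedLattice A] : ResiduatedLatticeHom A A where
  toFun x := x
  map_inf _ _ := rfl
  map_sup _ _ := rfl
  map_mul _ _ := rfl
  map_himp _ _ := rfl
  map_bot := rfl
  map_one := rfl

theorem map_pow (f : ResiduatedLatticeHom A B) (x : A) (n : ℕ) : f (x ^ n) = f x ^ n := by
  induction n with
  | zero => rw [pow_zero, pow_zero, f.map_one]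
  | succ n ih => rw [pow_succ, pow_succ, f.map_mul, ih]

theorem mono (f : ResiduatedLatticeHom A B) {x y : A} (h : x ≤ y) : f x ≤ f y := by
  rw [← inf_eq_left, ← f.map_inf, inf_eq_left.mpr h]

end ResiduatedLatticeHom

/-- The homomorphism into a power given by a family of homomorphisms. -/
def ResiduatedLatticeHom.pi {A : Type u} [BLAlgebra A] {I : Type v} {B : I → Type w}
    [∀ i, BLAlgebra (B i)] (φ : ∀ i, ResiduatedLatticeHom A (B i)) :
    ResiduatedLatticeHom A (∀ i, B i) where
  toFun x i := φ i x
  map_inf x y := funext fun i => (φ i).map_inf x y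
  map_sup x y := funext fun i => (φ i).map_sup x y
  map_mul x y := funext fun i => (φ i).map_mul x y
  map_himp x y := funext fun i => (φ i).map_himp x y
  map_bot := funext fun i => (φ i).map_bot
  map_one := funext fun i => (φ i).map_one

/-- Projections of a power. -/
def ResiduatedLatticeHom.proj {I : Type v} (B : I → Type w)
    [∀ i, BLAlgebra (B i)] (i : I) : ResiduatedLatticeHom (∀ i, B i) (B i) where
  toFun x := x i
  map_inf _ _ := rfl
  map_sup _ _ := rfl
  map_mul _ _ := rfl
  map_himp _ _ := rfl
  map_bot := rfl
  map_one := rfl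

/-! ### Injectivity of the standard MV-algebra -/

namespace StandardMV

open ResiduatedLattice

theorem val_pow (x : StandardMV) (n : ℕ) : (x ^ n).val = max 0 (1 - n * (1 - x.val)) := by
  induction n with
  | zero => simp [val_one]
  | succ n ih =>
    rw [pow_succ, val_mul, ih]
    push_cast
    grind [x.val_le_one, x.val_nonneg]

theorem bot_ne_one : (⊥ : StandardMV) ≠ 1 := fun h => by
  simpa [val_bot, val_one] using congrArg val h

theorem exists_pow_eq_bot {x : StandardMV} (h : x ≠ 1) : ∃ n : ℕ, x ^ n = ⊥ := by
  have hx : 0 < 1 - x.val := by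
    rcases x.val_le_one.lt_or_eq with h' | h'
    · linarith
    · exact absurd (ext h') h
  obtain ⟨n, hn⟩ := exists_nat_gt (1 / (1 - x.val))
  rw [div_lt_iff₀ hx] at hn
  exact ⟨n, ext (by rw [val_pow, val_bot]; exact max_eq_left (by linarith))⟩

variable {B : Type u} [BLAlgebra B] {φ ψ : ResiduatedLatticeHom B StandardMV}

/-- If φ x ≠ 1, then φ kills some x^n, so the negation of x^n lies in the filter of φ and hence in
that of ψ, which also contains x^n. -/
theorem eq_one_of_eq_one (h : ∀ x, φ x = 1 → ψ x = 1) {x : B} (hx : ψ x = 1) : φ x = 1 := by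
  by_contra hne
  obtain ⟨n, hn⟩ := exists_pow_eq_bot hne
  have h1 : φ (x ^ n ⇨ ⊥) = 1 := by
    rw [φ.map_himp, φ.map_pow, hn, φ.map_bot, himp_eq_one_iff]
  have h2 := h _ h1
  rw [ψ.map_himp, ψ.map_pow, hx, one_pow, one_himp, ψ.map_bot] at h2
  exact bot_ne_one h2

/-- The terms x * x and (x ⇨ ⊥) ⇨ x act on [0,1] as t ↦ max(0, 2t - 1) and t ↦ min(1, 2t). The
second equals 1 exactly when t ≥ 1/2, so equal filters put φ x and ψ x on the same side of 1/2,
where one of the two terms doubles their difference. -/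
theorem val_sub_val_le (h : ∀ x, φ x = 1 ↔ ψ x = 1) (n : ℕ) (x : B) :
    (ψ x).val - (φ x).val ≤ 1 / 2 ^ n := by
  induction n generalizing x with
  | zero => simpa using by linarith [(ψ x).val_le_one, (φ x).val_nonneg]
  | succ n ih =>
    have hsq := ih (x * x)
    have hdbl := ih ((x ⇨ ⊥) ⇨ x)
    have hcase := h ((x ⇨ ⊥) ⇨ x)
    have val_dbl : ∀ χ : ResiduatedLatticeHom B StandardMV,
        (χ ((x ⇨ ⊥) ⇨ x)).val = min 1 (2 * (χ x).val) := fun χ => by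
      rw [χ.map_himp, χ.map_himp, χ.map_bot, val_himp, val_himp, val_bot]
      grind [(χ x).val_nonneg]
    have eq_one_iff : ∀ y : StandardMV, y = 1 ↔ y.val = 1 := fun y =>
      ⟨fun h => by rw [h, val_one], fun h => ext h⟩
    rw [φ.map_mul, ψ.map_mul, val_mul, val_mul] at hsq
    rw [eq_one_iff, eq_one_iff, val_dbl, val_dbl] at hcase
    rw [val_dbl, val_dbl] at hdbl
    have hpow : (1 : ℝ) / 2 ^ n = 2 * (1 / 2 ^ (n + 1)) := by
      rw [pow_succ]
      field_simp
    have hp : (0 : ℝ) < 1 / 2 ^ (n + 1) := by positivity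
    rw [hpow] at hsq hdbl
    generalize (1 : ℝ) / 2 ^ (n + 1) = ε at *
    grind [(φ x).val_nonneg, (ψ x).val_nonneg, (φ x).val_le_one, (ψ x).val_le_one]

theorem val_le_val (h : ∀ x, φ x = 1 ↔ ψ x = 1) (x : B) : (ψ x).val ≤ (φ x).val := by
  by_contra! hlt
  obtain ⟨n, hn⟩ := exists_pow_lt_of_lt_one (sub_pos.mpr hlt) (show (1 / 2 : ℝ) < 1 by norm_num)
  have := val_sub_val_le h n x
  rw [one_div_pow] at hn
  linarith

/-- Homomorphisms to the standard MV-algebra are determined by their filters. -/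
theorem hom_ext_of_eq_one (h : ∀ x, φ x = 1 → ψ x = 1) (x : B) : φ x = ψ x := by
  have h' : ∀ x, φ x = 1 ↔ ψ x = 1 := fun x => ⟨h x, eq_one_of_eq_one h⟩
  exact ext (le_antisymm (val_le_val (fun x => (h' x).symm) x) (val_le_val h' x))

/-- The standard MV-algebra is injective among BL-algebras. -/
theorem exists_extension {C : Type v} [BLAlgebra C] (f : ResiduatedLatticeHom B C)
    (hf : Function.Injective f) (φ : ResiduatedLatticeHom B StandardMV) :
    ∃ ψ : ResiduatedLatticeHom C StandardMV, ∀ b, ψ (f b) = φ b := by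
  have hF : IsProperFilter {c : C | ∃ b, φ b = 1 ∧ f b ≤ c} := by
    refine ⟨⟨1, φ.map_one, le_one _⟩, ?_, ?_, ?_⟩
    · rintro x y ⟨b, hb, hx⟩ ⟨c, hc, hy⟩
      exact ⟨b * c, by rw [φ.map_mul, hb, hc, one_mul], by
        rw [f.map_mul]
        exact mul_le_mul' hx hy⟩
    · rintro x y ⟨b, hb, hx⟩ hxy
      exact ⟨b, hb, hx.trans hxy⟩
    · rintro ⟨b, hb, hx⟩
      -- Properness of the generated filter is where injectivity of f enters.
      have : b = ⊥ := hf (by rw [f.map_bot]; exact le_bot_iff.mp hx)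
      rw [this, φ.map_bot] at hb
      exact bot_ne_one hb
  obtain ⟨ψ, hψ⟩ := BLAlgebra.exists_hom_of_isProperFilter hF
  refine ⟨ψ, fun b => ?_⟩
  exact (hom_ext_of_eq_one (φ := φ) (ψ := ψ.comp f)
    (fun x hx => hψ _ ⟨x, hx, le_rfl⟩) b).symm

end StandardMV

theorem BLAlgebra.IsRetract.isInjective {A : Type u} [BLAlgebra A] {I : Type v}
    (h : IsRetract A (I → StandardMV)) : IsInjective A := by
  obtain ⟨s, p, hps⟩ := h
  intro B C _ _ f g hf
  choose ψ hψ using fun i => StandardMV.exists_extension f hf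
    ((ResiduatedLatticeHom.proj (fun _ : I => StandardMV) i).comp (s.comp g))
  refine ⟨p.comp (.pi ψ), fun b => ?_⟩
  rw [← hps (g b)]
  exact congrArg p.toFun (funext fun i => hψ i b)

/-! ### Gödel chains -/

/-- A bounded chain, as carrier of its Gödel algebra. -/
def GodelChain (α : Type u) : Type u := α

namespace GodelChain

variable {α : Type u} {β : Type v} [LinearOrder α] [BoundedOrder α] [LinearOrder β] [BoundedOrder β]

instance instLinearOrder : LinearOrder (GodelChain α) := inferInstanceAs (LinearOrder α)

instance instBoundedOrder : BoundedOrder (GodelChain α) := inferInstanceAs (BoundedOrder α)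

instance instCommMonoid : CommMonoid (GodelChain α) where
  mul x y := x ⊓ y
  one := ⊤
  mul_assoc := inf_assoc
  one_mul := top_inf_eq
  mul_one := inf_top_eq
  mul_comm := inf_comm

instance instHImp : HImp (GodelChain α) := ⟨fun x y => if x ≤ y then ⊤ else y⟩

theorem mul_def (x y : GodelChain α) : x * y = x ⊓ y := rfl

theorem one_def : (1 : GodelChain α) = ⊤ := rfl

theorem himp_def (x y : GodelChain α) : x ⇨ y = if x ≤ y then ⊤ else y := rfl

instance instBLAlgebra : BLAlgebra (GodelChain α) where
  one_eq_top := rfl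
  mul_himp x y z := by
    simp only [mul_def, himp_def, inf_le_iff]
    split_ifs <;> simp_all
  himp_mul_inf x y := by
    simp only [mul_def, himp_def]
    split_ifs with h <;> simp [h]
  inf_himp x y := by simp [himp_def, one_def]
  prelinear x y := by
    simp only [himp_def, one_def]
    rcases le_total x y with h | h <;> simp [h]
  mul_himp_self x y := by
    simp only [mul_def, himp_def]
    split_ifs with h <;> simp [h]

/-- A strictly monotone map of bounded chains preserving the bounds is a homomorphism of Gödel
algebras. -/
def homOfStrictMono (f : GodelChain α → GodelChain β) (hf : StrictMono f)
    (hbot : f ⊥ = ⊥) (htop : f ⊤ = ⊤) : ResiduatedLatticeHom (GodelChain α) (GodelChain β) where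
  toFun := f
  map_inf := hf.monotone.map_inf
  map_sup := hf.monotone.map_sup
  map_mul := hf.monotone.map_inf
  map_himp x y := by
    rw [himp_def, himp_def, apply_ite f, htop]
    exact if_congr hf.le_iff_le.symm rfl rfl
  map_bot := hbot
  map_one := htop

end GodelChain

open ResiduatedLattice

theorem exists_hom_godelChain_of_idempotent {α : Type u} [LinearOrder α] [BoundedOrder α]
    {A : Type v} [BLAlgebra A] {m : GodelChain α} (hm : ∀ x : GodelChain α, x = ⊥ ∨ x = m ∨ x = ⊤)
    (hbot : ⊥ < m) (htop : m < ⊤) {e : A} (he : e * e = e) (he' : e ⇨ ⊥ = ⊥) :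
    ∃ φ : ResiduatedLatticeHom (GodelChain α) A, φ m = e := by
  classical
  let g : GodelChain α → A := fun x => if x = ⊥ then ⊥ else if x = ⊤ then 1 else e
  have g0 : g ⊥ = ⊥ := if_pos rfl
  have g1 : g ⊤ = 1 := by simp [g, (hbot.trans htop).ne']
  have gm : g m = e := by simp [g, hbot.ne', htop.ne]
  have hone : ∀ x y : A, x ≤ y → x ⇨ y = 1 := fun _ _ h => himp_eq_one_iff.mpr h
  have hbt := hbot.trans htop
  have hm' : ¬ m ≤ ⊥ := hbot.not_ge
  have ht' : ¬ ⊤ ≤ m := htop.not_ge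
  have hbt' : ¬ (⊤ : GodelChain α) ≤ ⊥ := hbt.not_ge
  have e1 : e ⊓ 1 = e := inf_eq_left.mpr (le_one e)
  have e1' : e ⊔ 1 = 1 := sup_eq_right.mpr (le_one e)
  have e2 : 1 ⊓ e = e := inf_eq_right.mpr (le_one e)
  have e2' : 1 ⊔ e = 1 := sup_eq_left.mpr (le_one e)
  have b1 : ∀ x : A, ⊥ * x = ⊥ := fun x => by rw [mul_comm, mul_bot]
  refine ⟨⟨g, fun x y => ?_, fun x y => ?_, fun x y => ?_, fun x y => ?_, g0, g1⟩, gm⟩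
  · rcases hm x with rfl | rfl | rfl <;> rcases hm y with rfl | rfl | rfl <;>
      simp [g0, g1, gm, e1, e2]
  · rcases hm x with rfl | rfl | rfl <;> rcases hm y with rfl | rfl | rfl <;>
      simp [g0, g1, gm, e1', e2']
  · rcases hm x with rfl | rfl | rfl <;> rcases hm y with rfl | rfl | rfl <;>
      simp [GodelChain.mul_def, g0, g1, gm, he, b1, mul_bot]
  · rcases hm x with rfl | rfl | rfl <;> rcases hm y with rfl | rfl | rfl <;>
      simp [GodelChain.himp_def, g0, g1, gm, he', hone, one_himp, le_one, hm', ht', hbt']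

/-! ### Reduced powers -/

namespace Filter.Germ

variable {ι : Type u} {l : Filter ι} {A : Type v} [BLAlgebra A]

instance instHImp : HImp (Germ l A) := ⟨map₂ (· ⇨ ·)⟩

/-- Reduced powers of BL-algebras. -/
instance instBLAlgebra : BLAlgebra (Germ l A) where
  one_eq_top := congrArg (fun x : A => (x : Germ l A)) ResiduatedLattice.one_eq_top
  mul_himp x y z := inductionOn₃ x y z fun _ _ _ =>
    congrArg ofFun (funext fun _ => ResiduatedLattice.mul_himp _ _ _)
  himp_mul_inf x y := inductionOn₂ x y fun _ _ =>
    congrArg ofFun (funext fun _ => ResiduatedLattice.himp_mul_inf _ _)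
  inf_himp x y := inductionOn₂ x y fun _ _ =>
    congrArg ofFun (funext fun _ => ResiduatedLattice.inf_himp _ _)
  prelinear x y := inductionOn₂ x y fun _ _ =>
    congrArg ofFun (funext fun _ => MTLAlgebra.prelinear _ _)
  mul_himp_self x y := inductionOn₂ x y fun _ _ =>
    congrArg ofFun (funext fun _ => BLAlgebra.mul_himp_self _ _)

/-- The diagonal embedding into a reduced power. -/
def constHom (l : Filter ι) (A : Type v) [BLAlgebra A] : ResiduatedLatticeHom A (Germ l A) where
  toFun x := (x : Germ l A)
  map_inf _ _ := rfl
  map_sup _ _ := rfl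
  map_mul _ _ := rfl
  map_himp _ _ := rfl
  map_bot := rfl
  map_one := rfl

end Filter.Germ

/-! ### The radical of an injective algebra -/

namespace BLAlgebra

variable {A : Type u} [BLAlgebra A]

/-- The radical: the elements sent to `1` by all homomorphisms to the standard MV-algebra. -/
def radical (A : Type u) [BLAlgebra A] : Set A :=
  {x | ∀ φ : ResiduatedLatticeHom A StandardMV, φ x = 1}

theorem exists_pow_eq_bot_of_forall_ne_one {p : A}
    (h : ∀ φ : ResiduatedLatticeHom A StandardMV, φ p ≠ 1) : ∃ m : ℕ, p ^ m = ⊥ := by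
  by_contra! hp
  have hF : IsProperFilter {y | ∃ m : ℕ, p ^ m ≤ y} := by
    refine ⟨⟨0, by simp⟩, ?_, ?_, ?_⟩
    · rintro x y ⟨m, hx⟩ ⟨n, hy⟩
      exact ⟨m + n, by rw [pow_add]; exact mul_le_mul' hx hy⟩
    · rintro x y ⟨m, hx⟩ hxy
      exact ⟨m, hx.trans hxy⟩
    · rintro ⟨m, hx⟩
      exact hp m (le_bot_iff.mp hx)
  obtain ⟨φ, hφ⟩ := exists_hom_of_isProperFilter hF
  exact h φ (hφ p ⟨1, by simp⟩)

/-- This describes the radical by inequalities, which can be checked pointwise in a reduced power.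
-/
theorem mem_radical_iff {x : A} : x ∈ radical A ↔ ∀ n : ℕ, x ⇨ ⊥ ≤ x ^ n := by
  constructor
  · intro hx n
    -- Every φ sends this element to ⊥, so it is nilpotent, and powers of prelinearity leave only
    -- the other joinand.
    obtain ⟨m, hm⟩ := exists_pow_eq_bot_of_forall_ne_one (p := x ^ n ⇨ (x ⇨ ⊥)) fun φ h => by
      rw [φ.map_himp, φ.map_himp, φ.map_pow, hx φ, one_pow, one_himp, one_himp, φ.map_bot] at h
      exact StandardMV.bot_ne_one h
    have := sup_pow_eq_one (MTLAlgebra.prelinear (x ⇨ ⊥) (x ^ n)) m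
    rwa [hm, sup_bot_eq, himp_eq_one_iff] at this
  · intro h φ
    by_contra hne
    obtain ⟨n, hn⟩ := StandardMV.exists_pow_eq_bot hne
    have := φ.mono (h n)
    rw [φ.map_pow, hn, φ.map_himp, φ.map_bot, le_bot_iff] at this
    have hv := congrArg StandardMV.val this
    rw [StandardMV.val_himp, StandardMV.val_bot] at hv
    refine hne (StandardMV.ext ?_)
    rw [StandardMV.val_one]
    grind [(φ x).val_le_one]

theorem map_mem_radical {B : Type v} [BLAlgebra B] (f : ResiduatedLatticeHom A B) {x : A}
    (hx : x ∈ radical A) : f x ∈ radical B := fun φ => hx (φ.comp f)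

theorem one_mem_radical : (1 : A) ∈ radical A := fun φ => φ.map_one

theorem mul_mem_radical {x y : A} (hx : x ∈ radical A) (hy : y ∈ radical A) :
    x * y ∈ radical A := fun φ => by rw [φ.map_mul, hx φ, hy φ, one_mul]

open Filter in
theorem IsInjective.exists_isLeast_radical (hA : IsInjective A) : ∃ e, IsLeast (radical A) e := by
  have : Nonempty (radical A) := ⟨⟨1, one_mem_radical⟩⟩
  have : IsCodirectedOrder (radical A) := ⟨fun x y =>
    ⟨⟨x * y, mul_mem_radical x.2 y.2⟩, mul_le_left (x : A) y, mul_le_right (x : A) y⟩⟩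
  let C := Germ (atBot : Filter (radical A)) A
  obtain ⟨h, hh⟩ := hA A C (Germ.constHom _ A) (ResiduatedLatticeHom.id A)
    fun _ _ hxy => Germ.const_inj.mp hxy
  -- The germ of the inclusion along the downward filter of the radical lies in the radical of C and
  -- below every constant from the radical of A; the retraction carries it to the least element.
  let t : C := Germ.ofFun (fun x : radical A => (x : A))
  have ht : t ∈ radical C := mem_radical_iff.mpr fun n =>
    Germ.coe_le.mpr (Eventually.of_forall fun x => mem_radical_iff.mp x.2 n)
  refine ⟨h t, map_mem_radical h ht, fun x hx => ?_⟩
  have hle : t ≤ Germ.constHom _ A x := Germ.coe_le.mpr (eventually_le_atBot (⟨x, hx⟩ : radical A))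
  exact (h.mono hle).trans (hh x).le

theorem himp_bot_eq_bot_of_mul_self {e : A} (he : e * e = e) (h : e ⇨ ⊥ ≤ e) : e ⇨ ⊥ = ⊥ := by
  rw [← le_bot_iff]
  calc e ⇨ ⊥ = e ⊓ (e ⇨ ⊥) := (inf_eq_right.mpr h).symm
    _ = e * (e ⇨ (e ⇨ ⊥)) := (mul_himp_self _ _).symm
    _ = (e ⇨ ⊥) * e := by rw [← mul_himp, he, mul_comm]
    _ ≤ ⊥ := himp_mul_le _ _

theorem IsInjective.radical_eq (hA : IsInjective A) {x : A} (hx : x ∈ radical A) : x = 1 := by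
  obtain ⟨e, he, hmin⟩ := hA.exists_isLeast_radical
  have hee : e * e = e := le_antisymm (mul_le_left e e) (hmin (mul_mem_radical he he))
  have hbot : e ⇨ ⊥ = ⊥ :=
    himp_bot_eq_bot_of_mul_self hee (by simpa using mem_radical_iff.mp he 1)
  let α := WithBot (WithTop PUnit.{u + 1})
  let m : α := ((PUnit.unit : WithTop PUnit.{u + 1}) : α)
  have h0 : (⊥ : GodelChain α) < m := WithBot.bot_lt_coe _
  have h1 : (m : GodelChain α) < ⊤ := WithBot.coe_lt_coe.mpr (WithTop.coe_lt_top _)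
  have hcases : ∀ x : GodelChain α, x = ⊥ ∨ x = m ∨ x = ⊤ := by
    rintro (_ | _ | ⟨⟨⟩⟩)
    · exact Or.inl rfl
    · exact Or.inr (Or.inr rfl)
    · exact Or.inr (Or.inl rfl)
  obtain ⟨g, hg⟩ := exists_hom_godelChain_of_idempotent hcases h0 h1 hee hbot
  -- α is the chain ⊥ < m < ⊤. The map F fixes the bounds and skips one element of the four-element
  -- chain, namely s, just above the bottom.
  let F : α → WithBot α := WithBot.map WithBot.some
  have hF : StrictMono F := WithBot.coe_strictMono.withBot_map
  obtain ⟨h, hh⟩ := hA _ _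
    (GodelChain.homOfStrictMono (α := α) (β := WithBot α) F hF rfl rfl) g hF.injective
  let s : GodelChain (WithBot α) := ((⊥ : α) : WithBot α)
  let E : GodelChain (WithBot α) := ((m : α) : WithBot α)
  have hE : h E = e := (hh m).trans hg
  have hsE : s < E := WithBot.coe_lt_coe.mpr h0
  have hs0 : ⊥ < s := WithBot.bot_lt_coe _
  have hs_bot : s ⇨ ⊥ = ⊥ := by rw [GodelChain.himp_def, if_neg hs0.not_ge]
  have hEs : E ⇨ s = s := by rw [GodelChain.himp_def, if_neg hsE.not_ge]
  have hs : s ∈ radical (GodelChain (WithBot α)) :=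
    mem_radical_iff.mpr fun n => hs_bot ▸ bot_le
  -- Monotonicity gives h s ≤ e; minimality of e in the radical gives the converse.
  have hse : h s = e := le_antisymm ((h.mono hsE.le).trans hE.le) (hmin (map_mem_radical h hs))
  have he1 : e = 1 := by
    rw [← hse, ← hEs, h.map_himp, hE, hse, himp_eq_one_iff]
  exact le_antisymm (le_one x) (he1 ▸ hmin hx)

theorem IsInjective.exists_isRetract (hA : IsInjective A) :
    ∃ I : Type u, IsRetract A (I → StandardMV) := by
  let I := ResiduatedLatticeHom A StandardMV
  let s : ResiduatedLatticeHom A (I → StandardMV) := .pi fun φ => φ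
  have key : ∀ x y : A, s x = s y → x ≤ y := fun x y h => by
    rw [← himp_eq_one_iff]
    refine hA.radical_eq fun φ => ?_
    rw [φ.map_himp, show φ x = φ y from congrFun h φ, himp_eq_one_iff]
  obtain ⟨p, hp⟩ := hA A (I → StandardMV) s (ResiduatedLatticeHom.id A)
    fun x y h => le_antisymm (key x y h) (key y x h.symm)
  exact ⟨I, s, p, hp⟩

end BLAlgebra

theorem proposition11p6 (A : Type u) [BLAlgebra A] :
    BLAlgebra.IsInjective A ↔ ∃ I : Type u, BLAlgebra.IsRetract A (I → StandardMV) :=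
  ⟨fun h => h.exists_isRetract, fun ⟨_, h⟩ => h.isInjective⟩
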